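/- Let $M$ be a smooth manifold of dimension $2n+1$ with a Riemannian metric $g$ and Levi-Civita connection $\nabla$. A weak almost contact metric structure on $(M,g)$ is a set of smooth tensors $(f,Q,\xi,\eta)$, where $f$ is a $(1,1)$-tensor of rank $2n$, $Q$ a nonsingular $(1,1)$-tensor, $\xi$ a vector field and $\eta$ a 1-form, such that $f^2=-Q+\eta\otimes\xi$, $\eta(\xi)=1$, $Q\xi=\xi$, $g(fX,fY)=g(X,QY)-\eta(X)\eta(Y)$, and $\ker\eta$ is $f$-invariant. Let $\beta\neq 0$ be a real constant and suppose that $M$ is a weak $\beta$-Kenmotsu manifold, that is, $$(\nabla_X f)Y=\beta\{g(fX,Y)\,\xi-\eta(Y)\,fX\}$$ for all vector fields $X,Y$. Put $R_{X,Y}=[\nabla_X,\nabla_Y]-\nabla_{[X,Y]}$, $\mathrm{Ric}(X,Y)=\mathrm{trace}\,(Z\mapsto R_{Z,X}Y)$, let $\mathrm{Ric}^\sharp$ be the $(1,1)$-tensor with $g(\mathrm{Ric}^\sharp X,Y)=\mathrm{Ric}(X,Y)$, put $\widetilde Q=Q-\mathrm{id}$, and let $$\mathrm{Ric}^\ast(X,Y)=\tfrac12\,\mathrm{trace}\,(Z\mapsto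 f\,R_{X,fY}Z),\qquad r^\ast=\sum_i \mathrm{Ric}^\ast(e_i,e_i)$$ for an orthonormal basis $(e_i)$, be the $\ast$-Ricci tensor and the $\ast$-scalar curvature. Then, for all $X,Y$, $$\mathrm{Ric}^\ast(X,Y)=\mathrm{Ric}(X,QY)+\beta^2\{(2n-1)\,g(X,QY)+\eta(X)\eta(Y)\},$$ $$r^\ast=\mathrm{trace}(Q\,\mathrm{Ric}^\sharp)+\beta^2\{4n^2+(2n-1)\,\mathrm{trace}\,\widetilde Q\}.$$ -/

import Mathlib

open Bundle Manifold ContDiff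

noncomputable section

namespace WeakKenmotsu

/-! ### Traces -/

/-- The trace `∑ i, ⟪A eᵢ, eᵢ⟫` of an endomorphism `A` of a Euclidean vector space, with respect
to an orthonormal basis `(eᵢ)`. -/
def metricTrace {V : Type*} [NormedAddCommGroup V] [InnerProductSpace ℝ V]
    [FiniteDimensional ℝ V] (A : V → V) : ℝ :=
  ∑ i, inner ℝ (A (stdOrthonormalBasis ℝ V i)) (stdOrthonormalBasis ℝ V i)

/-- On linear maps `metricTrace` is the usual trace. -/
theorem metricTrace_eq_trace {V : Type*} [NormedAddCommGroup V] [InnerProductSpace ℝ V]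
    [FiniteDimensional ℝ V] (A : V →ₗ[ℝ] V) : metricTrace A = LinearMap.trace ℝ V A := by
  rw [LinearMap.trace_eq_sum_inner A (stdOrthonormalBasis ℝ V)]
  simp only [metricTrace, real_inner_comm]

variable {E : Type*} [NormedAddCommGroup E] [NormedSpace ℝ E] [FiniteDimensional ℝ E]
  {H : Type*} [TopologicalSpace H] {I : ModelWithCorners ℝ E H}
  {M : Type*} [TopologicalSpace M] [ChartedSpace H M] [IsManifold I ∞ M]

instance instFiniteDimensionalTangentSpace (x : M) : FiniteDimensional ℝ (TangentSpace I x) :=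
  inferInstanceAs (FiniteDimensional ℝ E)

/-! ### Curvature of an affine connection -/

/-- `R_{X,Y} Z = ∇_X ∇_Y Z - ∇_Y ∇_X Z - ∇_{[X,Y]} Z` for vector fields `X`, `Y`, `Z`.
Mathlib writes `cov σ x (X x)` for `(∇_X σ)(x)`. -/
def curvatureField (cov : CovariantDerivative I E (TangentSpace I : M → Type _))
    (X Y Z : Π x : M, TangentSpace I x) (x : M) : TangentSpace I x :=
  cov (fun y => cov Z y (Y y)) x (X x) - cov (fun y => cov Z y (X y)) x (Y x)
    - cov Z x (VectorField.mlieBracket I X Y x)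

/-- The curvature tensor `R_{u,v} w` on tangent vectors at `x`, obtained by extending the vectors
to vector fields that are smooth near `x`. -/
def curvature (cov : CovariantDerivative I E (TangentSpace I : M → Type _)) (x : M)
    (u v w : TangentSpace I x) : TangentSpace I x :=
  curvatureField cov (FiberBundle.extend E u) (FiberBundle.extend E v) (FiberBundle.extend E w) x

/-! ### Riemannian manifolds -/

variable [RiemannianBundle (fun x : M => TangentSpace I x)]

/-- `∇` is the Levi-Civita connection of the Riemannian manifold: a smooth affine connection
which is torsion-free and compatible with the metric. -/
structure IsLeviCivita (cov : CovariantDerivative I E (TangentSpace I : M → Type _)) : Prop where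
  smooth : cov.ContMDiffCovariantDerivative ∞
  torsion_eq_zero : cov.torsion = 0
  metric : ∀ (Y Z : Π x : M, TangentSpace I x) (x : M),
    MDifferentiableAt I (I.prod 𝓘(ℝ, E)) (fun y => TotalSpace.mk' E y (Y y)) x →
    MDifferentiableAt I (I.prod 𝓘(ℝ, E)) (fun y => TotalSpace.mk' E y (Z y)) x →
    ∀ u : TangentSpace I x, mvfderiv I (fun y => (inner ℝ (Y y) (Z y) : ℝ)) x u =
      inner ℝ (cov Y x u) (Z x) + inner ℝ (Y x) (cov Z x u)

/-- The Ricci tensor `Ric(u,v) = trace (z ↦ R_{z,u} v)`. -/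
def ricci (cov : CovariantDerivative I E (TangentSpace I : M → Type _)) (x : M)
    (u v : TangentSpace I x) : ℝ :=
  metricTrace (fun z : TangentSpace I x => curvature cov x z u v)

/-- The `(1,1)`-tensor `Ric♯` adjoint to the Ricci tensor, `g(Ric♯ u, v) = Ric(u,v)`. -/
def ricciSharp (cov : CovariantDerivative I E (TangentSpace I : M → Type _)) (x : M)
    (u : TangentSpace I x) : TangentSpace I x :=
  ∑ i, ricci cov x u (stdOrthonormalBasis ℝ (TangentSpace I x) i) •
    stdOrthonormalBasis ℝ (TangentSpace I x) i

/-! ### Weak almost contact metric structures -/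

variable (I M) in
/-- A weak almost contact metric structure `(f, Q, ξ, η)` on the Riemannian manifold `M`
(of dimension `2n+1`), with `ker η` invariant under `f`. -/
structure WeakAlmostContactMetricStructure (n : ℕ) where
  f : Π x : M, TangentSpace I x →L[ℝ] TangentSpace I x
  Q : Π x : M, TangentSpace I x →L[ℝ] TangentSpace I x
  ξ : Π x : M, TangentSpace I x
  η : Π x : M, TangentSpace I x →L[ℝ] ℝ
  smooth_f : ContMDiff I (I.prod 𝓘(ℝ, E →L[ℝ] E)) ∞
    (fun x => TotalSpace.mk' (E →L[ℝ] E) x (f x))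
  smooth_Q : ContMDiff I (I.prod 𝓘(ℝ, E →L[ℝ] E)) ∞
    (fun x => TotalSpace.mk' (E →L[ℝ] E) x (Q x))
  smooth_ξ : ContMDiff I (I.prod 𝓘(ℝ, E)) ∞ (fun x => TotalSpace.mk' E x (ξ x))
  smooth_η : ContMDiff I (I.prod 𝓘(ℝ, E →L[ℝ] ℝ)) ∞
    (fun x => TotalSpace.mk' (E →L[ℝ] ℝ) x (η x))
  rank_f : ∀ x, Module.finrank ℝ (LinearMap.range (f x).toLinearMap) = 2 * n
  nonsingular_Q : ∀ x, Function.Bijective (Q x)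
  f_sq : ∀ x (v : TangentSpace I x), f x (f x v) = - Q x v + η x v • ξ x
  η_ξ : ∀ x, η x (ξ x) = 1
  Q_ξ : ∀ x, Q x (ξ x) = ξ x
  compat : ∀ x (u v : TangentSpace I x),
    inner ℝ (f x u) (f x v) = inner ℝ u (Q x v) - η x u * η x v
  ker_invariant : ∀ x (v : TangentSpace I x), η x v = 0 → η x (f x v) = 0

namespace WeakAlmostContactMetricStructure

variable {n : ℕ} (S : WeakAlmostContactMetricStructure I M n)

/-- The tensor `Q̃ = Q - id`. -/
def Qtilde (x : M) : TangentSpace I x →L[ℝ] TangentSpace I x :=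
  S.Q x - ContinuousLinearMap.id ℝ (TangentSpace I x)

/-- The `∗`-Ricci tensor `Ric∗(u,v) = (1/2) trace (z ↦ f (R_{u, f v} z))`. -/
def starRicci (cov : CovariantDerivative I E (TangentSpace I : M → Type _)) (x : M)
    (u v : TangentSpace I x) : ℝ :=
  (1 / 2) * metricTrace (fun z : TangentSpace I x => S.f x (curvature cov x u (S.f x v) z))

/-- The `∗`-scalar curvature `r∗ = ∑ i, Ric∗(eᵢ, eᵢ)`, for an orthonormal basis `(eᵢ)`. -/
def starScalar (cov : CovariantDerivative I E (TangentSpace I : M → Type _)) (x : M) : ℝ :=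
  ∑ i, S.starRicci cov x (stdOrthonormalBasis ℝ (TangentSpace I x) i)
    (stdOrthonormalBasis ℝ (TangentSpace I x) i)

/-- With `cov` the Levi-Civita connection `∇`: the structure is weak `β`-Kenmotsu, i.e. `β` is a
nowhere zero smooth function, `(∇_X f) Y = β {g(f X, Y) ξ - η(Y) f X}` for all smooth vector
fields, where `(∇_X f) Y = ∇_X (f Y) - f (∇_X Y)`, and `dβ ∧ η = 0` if `n = 1`. -/
structure IsWeakKenmotsu (cov : CovariantDerivative I E (TangentSpace I : M → Type _))
    (β : M → ℝ) : Prop where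
  smooth_β : ContMDiff I 𝓘(ℝ, ℝ) ∞ β
  β_ne_zero : ∀ x, β x ≠ 0
  nabla_f : ∀ X Y : Π x : M, TangentSpace I x,
    ContMDiff I (I.prod 𝓘(ℝ, E)) ∞ (fun x => TotalSpace.mk' E x (X x)) →
    ContMDiff I (I.prod 𝓘(ℝ, E)) ∞ (fun x => TotalSpace.mk' E x (Y x)) →
    ∀ x, cov (fun y => S.f y (Y y)) x (X x) - S.f x (cov Y x (X x)) =
      β x • ((inner ℝ (S.f x (X x)) (Y x) : ℝ) • S.ξ x - S.η x (Y x) • S.f x (X x))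
  dβ_wedge_η : n = 1 → ∀ x (u v : TangentSpace I x),
    mvfderiv I β x u * S.η x v - mvfderiv I β x v * S.η x u = 0

end WeakAlmostContactMetricStructure

end WeakKenmotsu

end

/-! Differentiating the weak `β`-Kenmotsu condition once more gives the commutator of curvature and
`f` (`curvatureField_f`, `curvature_f`). Its right-hand side is exactly minus the commutator of `f`
with `β²` times the curvature tensor of constant curvature `1`, so `K = R + β² • constCurvature`
commutes with `f`.

The rest is linear algebra. For an algebraic curvature tensor commuting with a skew `f`, the Bianchi
identity and symmetry of Ricci give `tr (f ∘ K a b) = -2 Ric_K(a, f b)`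
(`trace_comp_eq_of_commute`). Replacing `b` by `f b`, and using `f² = -Q + η ⊗ ξ` with `K a b ξ =
0`, yields `2 Ric_K(a, Q b)`; removing the constant-curvature part from both sides is
`half_trace_comp_curvature`. The scalar formula is the trace of the Ricci one.

Since `curvature` is defined through chosen local extensions, its tensoriality and symmetries must
also be established (`curvatureField_congr`, `curvature_eq_curvatureField`). -/

noncomputable section

namespace WeakKenmotsu

set_option linter.unusedSectionVars false

/-! ### Algebraic curvature tensors commuting with a skew endomorphism -/

section Algebra

open Module

variable {V : Type*} [NormedAddCommGroup V] [InnerProductSpace ℝ V]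

/-- The trilinear map `(a, b, c) ↦ ⟪b, c⟫ a - ⟪a, c⟫ b`, the curvature tensor of constant
curvature `1`. -/
def constCurvature (V : Type*) [NormedAddCommGroup V] [InnerProductSpace ℝ V] :
    V →ₗ[ℝ] V →ₗ[ℝ] V →ₗ[ℝ] V :=
  LinearMap.mk₂ ℝ (fun a b => (innerₗ V b).smulRight a - (innerₗ V a).smulRight b)
    (fun a a' b => by ext c; simp [add_smul]; abel)
    (fun r a b => by ext c; simp [mul_smul, smul_sub, smul_comm r])
    (fun a b b' => by ext c; simp [add_smul]; abel)
    (fun r a b => by ext c; simp [mul_smul, smul_sub, smul_comm r])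

/-- The Ricci form of a trilinear map `K`, as an endomorphism to be traced: `z ↦ K z a b`. -/
def ricciEndomorphism (K : V →ₗ[ℝ] V →ₗ[ℝ] V →ₗ[ℝ] V) (a b : V) : V →ₗ[ℝ] V :=
  (K.flip a).flip b

@[simp]
theorem ricciEndomorphism_apply (K : V →ₗ[ℝ] V →ₗ[ℝ] V →ₗ[ℝ] V) (a b z : V) :
    ricciEndomorphism K a b z = K z a b := rfl

theorem inner_swap {K : V →ₗ[ℝ] V →ₗ[ℝ] V →ₗ[ℝ] V} (swap : ∀ a b c, K b a c = - K a b c)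
    (pair : ∀ a b c d, (inner ℝ (K a b c) d : ℝ) = inner ℝ (K c d a) b) (a b c d : V) :
    (inner ℝ (K a b d) c : ℝ) = - inner ℝ (K a b c) d := by
  rw [pair, swap, inner_neg_left, ← pair]

variable [FiniteDimensional ℝ V]

theorem trace_inner_smul (a b : V) :
    LinearMap.trace ℝ V ((innerₗ V a).smulRight b) = inner ℝ a b := by
  rw [LinearMap.trace_smulRight]
  rfl

/-- For an algebraic curvature tensor `K` commuting with a skew endomorphism `f`, the trace of
`f ∘ K_{a,b}` is `-2 Ric_K(a, f b)`. -/
theorem trace_comp_eq_of_commute {K : V →ₗ[ℝ] V →ₗ[ℝ] V →ₗ[ℝ] V} {f : V →ₗ[ℝ] V}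
    (swap : ∀ a b c, K b a c = - K a b c)
    (pair : ∀ a b c d, (inner ℝ (K a b c) d : ℝ) = inner ℝ (K c d a) b)
    (bianchi : ∀ a b c, K a b c + K b c a + K c a b = 0)
    (skew : ∀ a b, (inner ℝ (f a) b : ℝ) = - inner ℝ a (f b))
    (comm : ∀ a b c, K a b (f c) = f (K a b c)) (a b : V) :
    LinearMap.trace ℝ V (f ∘ₗ K a b) = -2 * LinearMap.trace ℝ V (ricciEndomorphism K a (f b)) := by
  -- Pair symmetry moves `f` from the last two slots, where it commutes past `K`, to the first two.
  have move : ∀ a b c, K a (f b) c = - K (f a) b c := by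
    intro a b c
    refine ext_inner_right ℝ fun d => ?_
    rw [pair, ← neg_eq_iff_eq_neg.mpr (skew _ _), ← comm, inner_neg_left, pair (f a)]
  have sym : ∀ a b, LinearMap.trace ℝ V (ricciEndomorphism K a b) =
      LinearMap.trace ℝ V (ricciEndomorphism K b a) := by
    intro a b
    simp only [LinearMap.trace_eq_sum_inner _ (stdOrthonormalBasis ℝ V), ricciEndomorphism_apply]
    refine Finset.sum_congr rfl fun i _ => ?_
    rw [real_inner_comm, pair, swap, inner_neg_left, inner_swap swap pair, neg_neg,
      real_inner_comm]
  -- Bianchi splits `K a b c` into two terms with `c` in the first slot. Each has trace `-Ric_K(a, f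
  -- b)` up to the sign shown: for the first, use symmetry of Ricci, `move` and cyclicity of the
  -- trace.
  have e : f ∘ₗ K a b = ricciEndomorphism K b (f a) - ricciEndomorphism K a (f b) := by
    ext c
    have h := bianchi a b c
    rw [swap c b a] at h
    simp only [LinearMap.comp_apply, LinearMap.sub_apply, ricciEndomorphism_apply, comm, ← map_sub]
    congr 1
    rw [← sub_eq_zero, ← h]
    abel
  have e2 : ricciEndomorphism K (f a) b = - (ricciEndomorphism K a b ∘ₗ f) := by
    ext c
    simp [move]
  have e3 : f ∘ₗ ricciEndomorphism K a b = ricciEndomorphism K a (f b) := by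
    ext c
    simp [comm]
  rw [e, map_sub, sym b, e2, map_neg, ← e3, ← Module.End.mul_eq_comp, LinearMap.trace_mul_comm,
    Module.End.mul_eq_comp]
  ring

/-- A curvature-like tensor `R` such that `R + c (⟪b, ·⟫ a - ⟪a, ·⟫ b)` commutes with the tensor `f`
of a weak almost contact metric vector space: the trace of `f ∘ R_{a,f b}`. -/
theorem half_trace_comp_curvature {R : V →ₗ[ℝ] V →ₗ[ℝ] V →ₗ[ℝ] V} {f Q : V →ₗ[ℝ] V} {ξ : V}
    {c : ℝ} {n : ℕ} (hn : finrank ℝ V = 2 * n + 1)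
    (swap : ∀ a b c, R b a c = - R a b c)
    (pair : ∀ a b c d, (inner ℝ (R a b c) d : ℝ) = inner ℝ (R c d a) b)
    (bianchi : ∀ a b c, R a b c + R b c a + R c a b = 0)
    (skew : ∀ a b, (inner ℝ (f a) b : ℝ) = - inner ℝ a (f b))
    (f_sq : ∀ a, f (f a) = - Q a + (inner ℝ ξ a : ℝ) • ξ)
    (ker_f : ∀ a, f a = 0 → a = (inner ℝ ξ a : ℝ) • ξ) (f_ξ : f ξ = 0)
    (comm : ∀ a b d, R a b (f d) = f (R a b d) +
      c • ((inner ℝ (f b) d : ℝ) • a - (inner ℝ a d : ℝ) • f b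
        - (inner ℝ (f a) d : ℝ) • b + (inner ℝ b d : ℝ) • f a)) (a b : V) :
    1 / 2 * LinearMap.trace ℝ V (f ∘ₗ R a (f b)) =
      LinearMap.trace ℝ V (ricciEndomorphism R a (Q b))
        + c * ((2 * n - 1) * inner ℝ a (Q b) + inner ℝ ξ a * inner ℝ ξ b) := by
  set K : V →ₗ[ℝ] V →ₗ[ℝ] V →ₗ[ℝ] V := R + c • constCurvature V
  have hKa : ∀ a b d, K a b d = R a b d + c • ((inner ℝ b d : ℝ) • a - (inner ℝ a d : ℝ) • b) :=
    fun a b d => rfl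
  have swapK : ∀ a b c, K b a c = - K a b c := by
    intro a b d
    rw [hKa, hKa, swap]
    module
  have pairK : ∀ a b c d, (inner ℝ (K a b c) d : ℝ) = inner ℝ (K c d a) b := by
    intro a b d e
    simp only [hKa, inner_add_left, inner_smul_left, inner_sub_left, pair a b d e,
      real_inner_comm, conj_trivial]
    ring
  have bianchiK : ∀ a b c, K a b c + K b c a + K c a b = 0 := by
    intro a b d
    rw [hKa, hKa, hKa, ← bianchi a b d, real_inner_comm d b, real_inner_comm d a,
      real_inner_comm a b]
    module
  have commK : ∀ a b d, K a b (f d) = f (K a b d) := by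
    intro a b d
    have h1 := skew a d
    have h2 := skew b d
    rw [hKa, hKa, comm, h1, h2]
    simp only [map_add, map_sub, map_smul]
    module
  -- `K a b ξ` lies in `ker f`, hence is a multiple of `ξ`; skewness of `K a b` makes it orthogonal
  -- to `ξ`.
  have Kξ : ∀ a b, K a b ξ = 0 := by
    intro a b
    have h := ker_f (K a b ξ) (by rw [← commK, f_ξ, map_zero])
    have h0 := inner_swap swapK pairK a b ξ ξ
    rw [h, real_inner_comm, show (inner ℝ (K a b ξ) ξ : ℝ) = 0 by linarith, zero_smul]
  have tr := trace_comp_eq_of_commute swapK pairK bianchiK skew commK a (f b)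
  have e1 : ricciEndomorphism K a (f (f b)) = - ricciEndomorphism K a (Q b) := by
    ext z
    simp only [ricciEndomorphism_apply, LinearMap.neg_apply, f_sq, map_add, map_neg, map_smul, Kξ,
      smul_zero, add_zero]
  -- The correction has trace `c ((2n+1) - 1) ⟪a, Q b⟫`. The one in `e3` has trace `2c (⟪a, Q b⟫ -
  -- η(a) η(b))`; half of it, subtracted, leaves the coefficient `2n - 1` and the term `+η(a) η(b)`.
  have e2 : ricciEndomorphism K a (Q b) = ricciEndomorphism R a (Q b) +
      c • ((inner ℝ a (Q b) : ℝ) • LinearMap.id - (innerₗ V (Q b)).smulRight a) := by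
    ext z
    simp [hKa, real_inner_comm]
  have e3 : f ∘ₗ K a (f b) = f ∘ₗ R a (f b) +
      c • ((innerₗ V (f b)).smulRight (f a) - (innerₗ V a).smulRight (f (f b))) := by
    ext z
    simp [hKa]
  rw [e1, e2, e3] at tr
  have hff : (inner ℝ (f b) (f a) : ℝ) = - inner ℝ a (f (f b)) := by
    rw [real_inner_comm, skew]
  have hffb : (inner ℝ a (f (f b)) : ℝ) = - inner ℝ a (Q b) + inner ℝ ξ b * inner ℝ ξ a := by
    rw [f_sq, inner_add_right, inner_neg_right, inner_smul_right, real_inner_comm ξ a]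
  simp only [map_add, map_neg, map_sub, map_smul, trace_inner_smul, LinearMap.trace_id, hn,
    smul_eq_mul, hff, hffb, real_inner_comm a (Q b)] at tr
  push_cast at tr
  linarith

end Algebra

open VectorField Topology

/-! ### Smooth extensions, Lie brackets and the Jacobi identity -/

section Curvature

variable {E : Type*} [NormedAddCommGroup E] [NormedSpace ℝ E] [FiniteDimensional ℝ E]
  {H : Type*} [TopologicalSpace H] {I : ModelWithCorners ℝ E H}
  {M : Type*} [TopologicalSpace M] [ChartedSpace H M] [IsManifold I ∞ M]
  {X Y Z W : Π x : M, TangentSpace I x}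

theorem mdifferentiableAt_of_contMDiff (hX : CMDiff ∞ (T% X)) (x : M) : MDiffAt (T% X) x :=
  (hX x).mdifferentiableAt (by simp)

/-- Every tangent vector is the value of a globally smooth vector field which agrees near the base
point with the extension chosen by `FiberBundle.extend`. -/
theorem exists_contMDiff_eventuallyEq_extend [T2Space M] (x : M) (v : TangentSpace I x) :
    ∃ V : Π y : M, TangentSpace I y, CMDiff ∞ (T% V) ∧
      V =ᶠ[𝓝 x] (FiberBundle.extend E v : Π y : M, TangentSpace I y) := by
  obtain ⟨s, hs, hsv⟩ := FiberBundle.exists_contMDiffOn_extend (k := ∞) (V := TangentSpace I) I E v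
  obtain ⟨u, hus, hu, hxu⟩ := mem_nhds_iff.mp hs
  obtain ⟨ψ, hψ⟩ := (SmoothBumpFunction.nhds_basis_support (I := I) (hu.mem_nhds hxu)).ex_mem
  refine ⟨(ψ : M → ℝ) • (FiberBundle.extend E v : Π y : M, TangentSpace I y),
    ContMDiffOn.smul_section_of_tsupport ψ.contMDiff.contMDiffOn hu hψ (hsv.mono hus), ?_⟩
  filter_upwards [ψ.eventuallyEq_one] with y hy
  rw [Pi.smul_apply', hy, Pi.one_apply, one_smul]

theorem exists_contMDiff_eq [T2Space M] (x : M) (v : TangentSpace I x) :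
    ∃ V : Π y : M, TangentSpace I y, CMDiff ∞ (T% V) ∧ V x = v := by
  obtain ⟨V, hV, e⟩ := exists_contMDiff_eventuallyEq_extend x v
  exact ⟨V, hV, by rw [e.self_of_nhds, FiberBundle.extend_apply_self]⟩

theorem contMDiff_mlieBracket (hX : CMDiff ∞ (T% X)) (hY : CMDiff ∞ (T% Y)) :
    CMDiff ∞ (T% (mlieBracket I X Y)) := by
  have : IsManifold I ((⊤ : ℕ∞) + 1) M := inferInstanceAs (IsManifold I ∞ M)
  have : IsManifold I (minSmoothness ℝ 2) M := by simpa using inferInstanceAs (IsManifold I 2 M)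
  exact fun x => ContMDiffAt.mlieBracket_vectorField (m := ⊤) (n := ⊤) (hX x) (hY x) (by simp)

theorem jacobi_mlieBracket (hX : CMDiff ∞ (T% X)) (hY : CMDiff ∞ (T% Y)) (hZ : CMDiff ∞ (T% Z))
    (x : M) : mlieBracket I X (mlieBracket I Y Z) x =
      mlieBracket I (mlieBracket I X Y) Z x + mlieBracket I Y (mlieBracket I X Z) x := by
  have : IsManifold I (minSmoothness ℝ 3) M := by simpa using inferInstanceAs (IsManifold I 3 M)
  have h2 : minSmoothness ℝ 2 ≤ (∞ : ℕ∞ω) := by simpa using ENat.LEInfty.out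
  exact leibniz_identity_mlieBracket_apply ((hX x).of_le h2) ((hY x).of_le h2) ((hZ x).of_le h2)

/-- `[X, Y] h = X (Y h) - Y (X h)`, deduced from the Jacobi identity applied to `X`, `Y` and `h W`
for a field `W` with `W x ≠ 0`. -/
theorem mvfderiv_mlieBracket [T2Space M] {h : M → ℝ} (hX : CMDiff ∞ (T% X))
    (hY : CMDiff ∞ (T% Y)) (hh : CMDiff ∞ h) (x : M)
    (hXh : MDiffAt (fun y => mvfderiv I h y (X y)) x)
    (hYh : MDiffAt (fun y => mvfderiv I h y (Y y)) x) :
    mvfderiv I h x (mlieBracket I X Y x) =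
      mvfderiv I (fun y => mvfderiv I h y (Y y)) x (X x)
        - mvfderiv I (fun y => mvfderiv I h y (X y)) x (Y x) := by
  -- In a zero tangent space no nonvanishing `W` exists, but both sides vanish.
  by_cases hE : ∀ w : TangentSpace I x, w = 0
  · simp [hE]
  push Not at hE
  obtain ⟨w, hw⟩ := hE
  obtain ⟨W, hW, hWw⟩ := exists_contMDiff_eq x w
  have hWx : W x ≠ 0 := hWw ▸ hw
  have key : ∀ {U V : Π y : M, TangentSpace I y}, CMDiff ∞ (T% U) → CMDiff ∞ (T% V) →
      MDiffAt (fun y => mvfderiv I h y (V y)) x →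
      mlieBracket I U (mlieBracket I V (h • W)) x =
        mvfderiv I (fun y => mvfderiv I h y (V y)) x (U x) • W x
          + mvfderiv I h x (V x) • mlieBracket I U W x
          + (mvfderiv I h x (U x) • mlieBracket I V W x
            + h x • mlieBracket I U (mlieBracket I V W) x) := by
    intro U V hU hV hVh
    have e : mlieBracket I V (h • W) =
        (fun y => mvfderiv I h y (V y)) • W + h • mlieBracket I V W := by
      ext1 y
      exact mlieBracket_smul_right ((hh y).mdifferentiableAt (by simp))
        (mdifferentiableAt_of_contMDiff hW y)
    have hWx' := mdifferentiableAt_of_contMDiff hW x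
    have hVW := mdifferentiableAt_of_contMDiff (contMDiff_mlieBracket hV hW) x
    have hhx : MDiffAt h x := (hh x).mdifferentiableAt (by simp)
    rw [e, mlieBracket_add_right (hVh.smul_section hWx') (hhx.smul_section hVW),
      mlieBracket_smul_right hVh hWx', mlieBracket_smul_right hhx hVW]
  have J := jacobi_mlieBracket hX hY (hh.smul_section hW) x
  rw [key hX hY hYh, key hY hX hXh, jacobi_mlieBracket hX hY hW x,
    mlieBracket_smul_right ((hh x).mdifferentiableAt (by simp))
      (mdifferentiableAt_of_contMDiff hW x)] at J
  have : (mvfderiv I h x (mlieBracket I X Y x) -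
      (mvfderiv I (fun y => mvfderiv I h y (Y y)) x (X x)
        - mvfderiv I (fun y => mvfderiv I h y (X y)) x (Y x))) • W x = 0 := by
    rw [← sub_eq_zero] at J
    rw [← neg_eq_zero, ← J]
    module
  exact sub_eq_zero.mp ((smul_eq_zero.mp this).resolve_right hWx)

/-! ### Symmetries and tensoriality of the Levi-Civita curvature -/

section LeviCivita

variable [RiemannianBundle (fun x : M => TangentSpace I x)]
  [IsContMDiffRiemannianBundle I ∞ E (fun x : M => TangentSpace I x)]
  {cov : CovariantDerivative I E (TangentSpace I : M → Type _)}

theorem contMDiff_inner (hX : CMDiff ∞ (T% X)) (hY : CMDiff ∞ (T% Y)) :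
    CMDiff ∞ (fun y => (inner ℝ (X y) (Y y) : ℝ)) :=
  ContMDiff.inner_bundle (F := E) (E := fun x : M => TangentSpace I x) (b := fun y => y) hX hY

namespace IsLeviCivita

theorem contMDiff_cov (hcov : IsLeviCivita cov) (hX : CMDiff ∞ (T% X)) (hZ : CMDiff ∞ (T% Z)) :
    CMDiff ∞ (T% (fun y => cov Z y (X y))) := by
  have h := hcov.smooth.contMDiff.contMDiff (σ := Z) (by simpa using! hZ.contMDiffOn)
  rw [contMDiffOn_univ] at h
  exact h.clm_bundle_apply hX

theorem cov_sub_cov (hcov : IsLeviCivita cov) (hX : CMDiff ∞ (T% X)) (hY : CMDiff ∞ (T% Y))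
    (x : M) : cov Y x (X x) - cov X x (Y x) = mlieBracket I X Y x :=
  (CovariantDerivative.torsion_eq_zero_iff cov).mp hcov.torsion_eq_zero
    (mdifferentiableAt_of_contMDiff hX x) (mdifferentiableAt_of_contMDiff hY x)

theorem mvfderiv_inner (hcov : IsLeviCivita cov) (hY : CMDiff ∞ (T% Y)) (hZ : CMDiff ∞ (T% Z))
    (x : M) (u : TangentSpace I x) :
    mvfderiv I (fun y => (inner ℝ (Y y) (Z y) : ℝ)) x u =
      inner ℝ (cov Y x u) (Z x) + inner ℝ (Y x) (cov Z x u) :=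
  hcov.metric Y Z x (mdifferentiableAt_of_contMDiff hY x) (mdifferentiableAt_of_contMDiff hZ x) u

end IsLeviCivita

theorem cov_add (hX : CMDiff ∞ (T% X)) (hY : CMDiff ∞ (T% Y)) (x : M) (u : TangentSpace I x) :
    cov (fun y => X y + Y y) x u = cov X x u + cov Y x u :=
  congr($(cov.isCovariantDerivativeOnUniv.add (mdifferentiableAt_of_contMDiff hX x)
    (mdifferentiableAt_of_contMDiff hY x)) u)

theorem cov_smul {h : M → ℝ} (hh : CMDiff ∞ h) (hX : CMDiff ∞ (T% X)) (x : M)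
    (u : TangentSpace I x) :
    cov (fun y => h y • X y) x u = h x • cov X x u + mvfderiv I h x u • X x :=
  congr($(cov.isCovariantDerivativeOnUniv.leibniz (mdifferentiableAt_of_contMDiff hX x)
    ((hh x).mdifferentiableAt (by simp))) u)

theorem cov_const_smul (c : ℝ) (hX : CMDiff ∞ (T% X)) (x : M)
    (u : TangentSpace I x) : cov (fun y => c • X y) x u = c • cov X x u := by
  rw [cov_smul (h := fun _ => c) contMDiff_const hX, mvfderiv_const]
  simp

theorem cov_sub (hX : CMDiff ∞ (T% X)) (hY : CMDiff ∞ (T% Y)) (x : M) (u : TangentSpace I x) :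
    cov (fun y => X y - Y y) x u = cov X x u - cov Y x u := by
  have h := cov_add (cov := cov) (hX.sub_section hY) hY x u
  simp only [Pi.sub_apply, sub_add_cancel] at h
  exact eq_sub_of_add_eq h.symm

theorem curvatureField_swap (x : M) :
    curvatureField cov Y X Z x = - curvatureField cov X Y Z x := by
  simp only [curvatureField]
  rw [mlieBracket_swap_apply, map_neg]
  abel

/-- Apply `[X, Y] = XY - YX` to the function `⟪Z, W⟫` and expand by metric compatibility: the mixed
first-derivative terms are symmetric in `X`, `Y` and cancel. -/
theorem inner_curvatureField_right [T2Space M] (hcov : IsLeviCivita cov)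
    (hX : CMDiff ∞ (T% X)) (hY : CMDiff ∞ (T% Y)) (hZ : CMDiff ∞ (T% Z)) (hW : CMDiff ∞ (T% W))
    (x : M) : (inner ℝ (curvatureField cov X Y Z x) (W x) : ℝ) =
      - inner ℝ (Z x) (curvatureField cov X Y W x) := by
  have key : ∀ {U V : Π y : M, TangentSpace I y}, CMDiff ∞ (T% U) → CMDiff ∞ (T% V) →
      CMDiff ∞ (fun y => mvfderiv I (fun y => (inner ℝ (Z y) (W y) : ℝ)) y (V y)) ∧
      mvfderiv I (fun y => mvfderiv I (fun y => (inner ℝ (Z y) (W y) : ℝ)) y (V y)) x (U x) =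
        inner ℝ (cov (fun y => cov Z y (V y)) x (U x)) (W x)
          + inner ℝ (cov Z x (V x)) (cov W x (U x))
          + (inner ℝ (cov Z x (U x)) (cov W x (V x))
            + inner ℝ (Z x) (cov (fun y => cov W y (V y)) x (U x))) := by
    intro U V hU hV
    have hZV := hcov.contMDiff_cov hV hZ
    have hWV := hcov.contMDiff_cov hV hW
    have e : (fun y => mvfderiv I (fun y => (inner ℝ (Z y) (W y) : ℝ)) y (V y)) =
        (fun y => inner ℝ (cov Z y (V y)) (W y)) + fun y => inner ℝ (Z y) (cov W y (V y)) := by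
      ext1 y
      exact hcov.mvfderiv_inner hZ hW y (V y)
    have h1 : CMDiff ∞ (fun y => (inner ℝ (cov Z y (V y)) (W y) : ℝ)) := contMDiff_inner hZV hW
    have h2 : CMDiff ∞ (fun y => (inner ℝ (Z y) (cov W y (V y)) : ℝ)) := contMDiff_inner hZ hWV
    rw [e]
    refine ⟨h1.add h2, ?_⟩
    rw [mvfderiv_add ((h1 x).mdifferentiableAt (by simp)) ((h2 x).mdifferentiableAt (by simp)),
      add_apply, hcov.mvfderiv_inner hZV hW, hcov.mvfderiv_inner hZ hWV]
  obtain ⟨sX, eX⟩ := key hY hX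
  obtain ⟨sY, eY⟩ := key hX hY
  have h := mvfderiv_mlieBracket hX hY (contMDiff_inner hZ hW) x
    ((sX x).mdifferentiableAt (by simp)) ((sY x).mdifferentiableAt (by simp))
  rw [eX, eY, hcov.mvfderiv_inner hZ hW] at h
  simp only [curvatureField, inner_sub_left, inner_sub_right]
  linarith

theorem curvatureField_bianchi (hcov : IsLeviCivita cov)
    (hX : CMDiff ∞ (T% X)) (hY : CMDiff ∞ (T% Y)) (hZ : CMDiff ∞ (T% Z)) (x : M) :
    curvatureField cov X Y Z x + curvatureField cov Y Z X x + curvatureField cov Z X Y x = 0 := by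
  -- Grouping the cyclic sum by the outer direction `T`, vanishing torsion used twice turns each
  -- group into a double bracket; what remains is Jacobi.
  have key : ∀ {U V T : Π y : M, TangentSpace I y}, CMDiff ∞ (T% U) → CMDiff ∞ (T% V) →
      CMDiff ∞ (T% T) → cov (fun y => cov V y (U y)) x (T x) - cov (fun y => cov U y (V y)) x (T x)
        - cov T x (mlieBracket I U V x) = mlieBracket I T (mlieBracket I U V) x := by
    intro U V T hU hV hT
    rw [← hcov.cov_sub_cov hT (contMDiff_mlieBracket hU hV),
      ← cov_sub (hcov.contMDiff_cov hU hV) (hcov.contMDiff_cov hV hU)]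
    simp only [hcov.cov_sub_cov hU hV]
  have J := jacobi_mlieBracket hX hY hZ x
  have s1 : mlieBracket I Z (mlieBracket I X Y) x = - mlieBracket I (mlieBracket I X Y) Z x :=
    mlieBracket_swap_apply
  have s2 : mlieBracket I Y (mlieBracket I Z X) x = - mlieBracket I Y (mlieBracket I X Z) x := by
    rw [mlieBracket_swap (V := Z)]
    have := mlieBracket_const_smul_right (c := (-1 : ℝ)) (V := Y)
      (mdifferentiableAt_of_contMDiff (contMDiff_mlieBracket hX hZ) x)
    simpa using this
  have e1 := key hX hY hZ
  have e2 := key hY hZ hX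
  have e3 := key hZ hX hY
  rw [s1] at e1
  rw [s2] at e3
  simp only [curvatureField]
  rw [← sub_eq_zero] at J e1 e2 e3
  have : ∀ a b c d : TangentSpace I x, a = 0 → b = 0 → c = 0 → d = 0 → a + b + c + d = 0 := by
    rintro a b c d rfl rfl rfl rfl
    simp
  rw [← this _ _ _ _ J e1 e2 e3]
  abel

/-- The classical octahedron argument: four Bianchi identities combined with skewness in each pair
of slots. -/
theorem inner_curvatureField_pair [T2Space M] (hcov : IsLeviCivita cov)
    (hX : CMDiff ∞ (T% X)) (hY : CMDiff ∞ (T% Y)) (hZ : CMDiff ∞ (T% Z)) (hW : CMDiff ∞ (T% W))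
    (x : M) : (inner ℝ (curvatureField cov X Y Z x) (W x) : ℝ) =
      inner ℝ (curvatureField cov Z W X x) (Y x) := by
  have sw : ∀ {A B C : Π y : M, TangentSpace I y} {w : TangentSpace I x},
      (inner ℝ (curvatureField cov B A C x) w : ℝ) = - inner ℝ (curvatureField cov A B C x) w := by
    intro A B C w
    rw [curvatureField_swap, inner_neg_left]
  have sk : ∀ {A B C D : Π y : M, TangentSpace I y}, CMDiff ∞ (T% A) → CMDiff ∞ (T% B) →
      CMDiff ∞ (T% C) → CMDiff ∞ (T% D) → (inner ℝ (curvatureField cov A B D x) (C x) : ℝ) =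
        - inner ℝ (curvatureField cov A B C x) (D x) := by
    intro A B C D hA hB hC hD
    rw [inner_curvatureField_right hcov hA hB hD hC, real_inner_comm]
  have bi : ∀ {A B C D : Π y : M, TangentSpace I y}, CMDiff ∞ (T% A) → CMDiff ∞ (T% B) →
      CMDiff ∞ (T% C) → (inner ℝ (curvatureField cov A B C x) (D x) : ℝ) +
        inner ℝ (curvatureField cov B C A x) (D x) + inner ℝ (curvatureField cov C A B x) (D x)
        = 0 := by
    intro A B C D hA hB hC
    rw [← inner_add_left, ← inner_add_left, curvatureField_bianchi hcov hA hB hC, inner_zero_left]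
  have b1 := bi (D := W) hX hY hZ
  have b2 := bi (D := X) hY hZ hW
  have b3 := bi (D := Y) hZ hW hX
  have b4 := bi (D := Z) hW hX hY
  have k1 := sk hX hY hZ hW
  have k2 := sk hY hZ hX hW
  have k3 := sk hZ hX hY hW
  have k4 := sk hZ hW hX hY
  have k5 := sk hW hY hX hZ
  have k6 := sk hW hX hY hZ
  have w1 := sw (A := W) (B := Y) (C := Z) (w := X x)
  have w2 := sw (A := W) (B := Y) (C := X) (w := Z x)
  have w3 := sw (A := Z) (B := X) (C := Y) (w := W x)
  have w4 := sw (A := Z) (B := X) (C := W) (w := Y x)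
  have w5 := sw (A := Y) (B := W) (C := Z) (w := X x)
  linarith

/-- Tensoriality without Leibniz computations: skew-adjointness moves all derivatives off `Z`, so
only `Z x` matters. Pair symmetry carries this to the first slot, and antisymmetry to the second. -/
theorem curvatureField_congr [T2Space M] (hcov : IsLeviCivita cov)
    {X' Y' Z' : Π y : M, TangentSpace I y}
    (hX : CMDiff ∞ (T% X)) (hY : CMDiff ∞ (T% Y)) (hZ : CMDiff ∞ (T% Z))
    (hX' : CMDiff ∞ (T% X')) (hY' : CMDiff ∞ (T% Y')) (hZ' : CMDiff ∞ (T% Z')) {x : M}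
    (eX : X x = X' x) (eY : Y x = Y' x) (eZ : Z x = Z' x) :
    curvatureField cov X Y Z x = curvatureField cov X' Y' Z' x := by
  have third : ∀ {A B C D : Π y : M, TangentSpace I y}, CMDiff ∞ (T% A) → CMDiff ∞ (T% B) →
      CMDiff ∞ (T% C) → CMDiff ∞ (T% D) → C x = D x →
      curvatureField cov A B C x = curvatureField cov A B D x := by
    intro A B C D hA hB hC hD h
    refine ext_inner_right ℝ fun w => ?_
    obtain ⟨W, hW, hw⟩ := exists_contMDiff_eq x w
    rw [← hw, inner_curvatureField_right hcov hA hB hC hW, h,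
      inner_curvatureField_right hcov hA hB hD hW]
  have first : ∀ {A B C D : Π y : M, TangentSpace I y}, CMDiff ∞ (T% A) → CMDiff ∞ (T% B) →
      CMDiff ∞ (T% C) → CMDiff ∞ (T% D) → A x = D x →
      curvatureField cov A B C x = curvatureField cov D B C x := by
    intro A B C D hA hB hC hD h
    refine ext_inner_right ℝ fun w => ?_
    obtain ⟨W, hW, hw⟩ := exists_contMDiff_eq x w
    rw [← hw, inner_curvatureField_pair hcov hA hB hC hW, third hC hW hA hD h,
      inner_curvatureField_pair hcov hD hB hC hW]
  rw [third hX hY hZ hZ' eZ, first hX hY hZ' hX' eX, curvatureField_swap,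
    first hY hX' hZ' hY' eY, ← curvatureField_swap]

/-- The extensions in `curvature` are controlled only near `x`, so they are replaced by global
smooth fields with the same germ; `curvatureField` depends only on germs, and then only on values.
-/
theorem curvature_eq_curvatureField [T2Space M] (hcov : IsLeviCivita cov)
    (hX : CMDiff ∞ (T% X)) (hY : CMDiff ∞ (T% Y)) (hZ : CMDiff ∞ (T% Z)) (x : M) :
    curvature cov x (X x) (Y x) (Z x) = curvatureField cov X Y Z x := by
  obtain ⟨A, hA, eA⟩ := exists_contMDiff_eventuallyEq_extend x (X x)
  obtain ⟨B, hB, eB⟩ := exists_contMDiff_eventuallyEq_extend x (Y x)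
  obtain ⟨C, hC, eC⟩ := exists_contMDiff_eventuallyEq_extend x (Z x)
  have cov_congr : ∀ {U V : Π y : M, TangentSpace I y} {y : M}, CMDiff ∞ (T% U) →
      U =ᶠ[𝓝 y] V → cov U y = cov V y := by
    intro U V y hU h
    have hU' := mdifferentiableAt_of_contMDiff hU y
    refine cov.isCovariantDerivativeOnUniv.congr_of_eventuallyEq hU' ?_ Filter.univ_mem h
    refine hU'.congr_of_eventuallyEq ?_
    filter_upwards [h] with z hz
    rw [hz]
  have inner_congr : ∀ {U V : Π y : M, TangentSpace I y},
      CMDiff ∞ (T% U) → U =ᶠ[𝓝 x] V →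
      cov (fun y => cov (FiberBundle.extend E (Z x)) y (V y)) x = cov (fun y => cov C y (U y)) x := by
    intro U V hU h
    symm
    refine cov_congr (hcov.contMDiff_cov hU hC) ?_
    -- The inner derivative is differentiated again, so it must agree at all points near `x`.
    filter_upwards [h, eC.eventuallyEq_nhds] with y hy hCy
    rw [cov_congr hC hCy, hy]
  rw [curvatureField_congr hcov hX hY hZ hA hB hC]
  · simp only [curvature, curvatureField]
    rw [inner_congr hA eA, inner_congr hB eB, ← cov_congr hC eC, ← eA.self_of_nhds,
      ← eB.self_of_nhds, eA.mlieBracket_vectorField_eq eB]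
  · rw [eA.self_of_nhds, FiberBundle.extend_apply_self]
  · rw [eB.self_of_nhds, FiberBundle.extend_apply_self]
  · rw [eC.self_of_nhds, FiberBundle.extend_apply_self]

theorem curvatureField_add (hcov : IsLeviCivita cov) (hX : CMDiff ∞ (T% X))
    (hY : CMDiff ∞ (T% Y)) (hZ : CMDiff ∞ (T% Z)) (hW : CMDiff ∞ (T% W)) (x : M) :
    curvatureField cov X Y (fun y => Z y + W y) x =
      curvatureField cov X Y Z x + curvatureField cov X Y W x := by
  simp only [curvatureField, cov_add hZ hW]
  rw [cov_add (hcov.contMDiff_cov hY hZ) (hcov.contMDiff_cov hY hW),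
    cov_add (hcov.contMDiff_cov hX hZ) (hcov.contMDiff_cov hX hW)]
  abel

theorem curvatureField_const_smul (hcov : IsLeviCivita cov) (hX : CMDiff ∞ (T% X))
    (hY : CMDiff ∞ (T% Y)) (hZ : CMDiff ∞ (T% Z)) (c : ℝ) (x : M) :
    curvatureField cov X Y (fun y => c • Z y) x = c • curvatureField cov X Y Z x := by
  simp only [curvatureField, cov_const_smul c hZ]
  rw [cov_const_smul c (hcov.contMDiff_cov hY hZ), cov_const_smul c (hcov.contMDiff_cov hX hZ)]
  simp only [smul_sub]

/-! ### The curvature tensor at a point -/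

section Tensor

variable [T2Space M] (hcov : IsLeviCivita cov) (x : M)
include hcov

theorem curvature_swap (u v w : TangentSpace I x) :
    curvature cov x v u w = - curvature cov x u v w := by
  obtain ⟨X, hX, rfl⟩ := exists_contMDiff_eq x u
  obtain ⟨Y, hY, rfl⟩ := exists_contMDiff_eq x v
  obtain ⟨Z, hZ, rfl⟩ := exists_contMDiff_eq x w
  rw [curvature_eq_curvatureField hcov hX hY hZ, curvature_eq_curvatureField hcov hY hX hZ,
    curvatureField_swap]

theorem inner_curvature_pair (u v w z : TangentSpace I x) :
    (inner ℝ (curvature cov x u v w) z : ℝ) = inner ℝ (curvature cov x w z u) v := by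
  obtain ⟨X, hX, rfl⟩ := exists_contMDiff_eq x u
  obtain ⟨Y, hY, rfl⟩ := exists_contMDiff_eq x v
  obtain ⟨Z, hZ, rfl⟩ := exists_contMDiff_eq x w
  obtain ⟨W, hW, rfl⟩ := exists_contMDiff_eq x z
  rw [curvature_eq_curvatureField hcov hX hY hZ, curvature_eq_curvatureField hcov hZ hW hX,
    inner_curvatureField_pair hcov hX hY hZ hW]

theorem curvature_bianchi (u v w : TangentSpace I x) :
    curvature cov x u v w + curvature cov x v w u + curvature cov x w u v = 0 := by
  obtain ⟨X, hX, rfl⟩ := exists_contMDiff_eq x u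
  obtain ⟨Y, hY, rfl⟩ := exists_contMDiff_eq x v
  obtain ⟨Z, hZ, rfl⟩ := exists_contMDiff_eq x w
  rw [curvature_eq_curvatureField hcov hX hY hZ, curvature_eq_curvatureField hcov hY hZ hX,
    curvature_eq_curvatureField hcov hZ hX hY, curvatureField_bianchi hcov hX hY hZ]

theorem curvature_add_right (u v w z : TangentSpace I x) :
    curvature cov x u v (w + z) = curvature cov x u v w + curvature cov x u v z := by
  obtain ⟨X, hX, rfl⟩ := exists_contMDiff_eq x u
  obtain ⟨Y, hY, rfl⟩ := exists_contMDiff_eq x v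
  obtain ⟨Z, hZ, rfl⟩ := exists_contMDiff_eq x w
  obtain ⟨W, hW, rfl⟩ := exists_contMDiff_eq x z
  rw [curvature_eq_curvatureField hcov hX hY hZ, curvature_eq_curvatureField hcov hX hY hW,
    ← curvatureField_add hcov hX hY hZ hW]
  exact curvature_eq_curvatureField hcov hX hY (hZ.add_section hW) x

theorem curvature_smul_right (c : ℝ) (u v w : TangentSpace I x) :
    curvature cov x u v (c • w) = c • curvature cov x u v w := by
  obtain ⟨X, hX, rfl⟩ := exists_contMDiff_eq x u
  obtain ⟨Y, hY, rfl⟩ := exists_contMDiff_eq x v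
  obtain ⟨Z, hZ, rfl⟩ := exists_contMDiff_eq x w
  rw [curvature_eq_curvatureField hcov hX hY hZ, ← curvatureField_const_smul hcov hX hY hZ]
  exact curvature_eq_curvatureField hcov hX hY (hZ.const_smul_section (a := c)) x

theorem curvature_add_left (u u' v w : TangentSpace I x) :
    curvature cov x (u + u') v w = curvature cov x u v w + curvature cov x u' v w := by
  refine ext_inner_right ℝ fun z => ?_
  rw [inner_add_left, inner_curvature_pair hcov, inner_curvature_pair hcov x u,
    inner_curvature_pair hcov x u', curvature_add_right hcov, inner_add_left]

theorem curvature_smul_left (c : ℝ) (u v w : TangentSpace I x) :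
    curvature cov x (c • u) v w = c • curvature cov x u v w := by
  refine ext_inner_right ℝ fun z => ?_
  rw [inner_smul_left, inner_curvature_pair hcov, inner_curvature_pair hcov x u,
    curvature_smul_right hcov, inner_smul_left]

/-- The curvature tensor at a point, as a trilinear map. -/
def curvatureLinear : TangentSpace I x →ₗ[ℝ] TangentSpace I x →ₗ[ℝ]
    TangentSpace I x →ₗ[ℝ] TangentSpace I x :=
  LinearMap.mk₂ ℝ
    (fun u v =>
      { toFun := curvature cov x u v
        map_add' := curvature_add_right hcov x u v
        map_smul' := fun c => curvature_smul_right hcov x c u v })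
    (fun u u' v => LinearMap.ext fun w => curvature_add_left hcov x u u' v w)
    (fun c u v => LinearMap.ext fun w => curvature_smul_left hcov x c u v w)
    (fun u v v' => LinearMap.ext fun w => by
      change curvature cov x u (v + v') w = curvature cov x u v w + curvature cov x u v' w
      rw [curvature_swap hcov, curvature_add_left hcov, curvature_swap hcov x u v,
        curvature_swap hcov x u v', neg_add, neg_neg, neg_neg])
    (fun c u v => LinearMap.ext fun w => by
      change curvature cov x u (c • v) w = c • curvature cov x u v w
      rw [curvature_swap hcov, curvature_smul_left hcov, curvature_swap hcov x u v, smul_neg,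
        neg_neg])

end Tensor

namespace WeakAlmostContactMetricStructure

/-! ### Pointwise algebra of weak almost contact metric structures -/

section Pointwise

variable {n : ℕ} (S : WeakAlmostContactMetricStructure I M n) (x : M)

theorem eq_of_f_eq_zero {v : TangentSpace I x} (h : S.f x v = 0) : v = S.η x v • S.ξ x := by
  have h2 := S.f_sq x v
  rw [h, map_zero] at h2
  apply (S.nonsingular_Q x).1
  rw [map_smul, S.Q_ξ]
  exact (neg_add_eq_zero.mp h2.symm)

/-- Since `f² ξ = 0`, `f ξ` is a multiple of `ξ`; applying `f` again forces the multiple or `f ξ` to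
vanish. -/
theorem f_ξ : S.f x (S.ξ x) = 0 := by
  have h := S.f_sq x (S.ξ x)
  rw [S.Q_ξ, S.η_ξ, one_smul, neg_add_cancel] at h
  have h1 := S.eq_of_f_eq_zero x h
  rw [h1, map_smul, smul_eq_zero] at h
  rcases h with h | h
  · rw [h1, h, zero_smul]
  · exact h

theorem η_f (v : TangentSpace I x) : S.η x (S.f x v) = 0 := by
  have h := S.ker_invariant x (v - S.η x v • S.ξ x) (by simp [S.η_ξ])
  simpa [S.f_ξ] using h

theorem inner_Q_comm (u v : TangentSpace I x) :
    (inner ℝ (S.Q x u) v : ℝ) = inner ℝ u (S.Q x v) := by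
  have h1 := S.compat x u v
  have h2 := S.compat x v u
  rw [real_inner_comm] at h2
  rw [real_inner_comm]
  linarith

theorem inner_ξ (v : TangentSpace I x) : (inner ℝ (S.ξ x) v : ℝ) = S.η x v := by
  have h := S.compat x (S.ξ x) v
  rw [S.f_ξ, inner_zero_left, S.η_ξ, ← S.inner_Q_comm, S.Q_ξ] at h
  linarith

theorem inner_f_left (u v : TangentSpace I x) :
    (inner ℝ (S.f x u) v : ℝ) = - inner ℝ u (S.f x v) := by
  have key : ∀ u v : TangentSpace I x,
      (inner ℝ (S.f x u) (S.f x v) : ℝ) = - inner ℝ u (S.f x (S.f x v)) := by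
    intro u v
    rw [S.compat, S.f_sq, inner_add_right, inner_neg_right, inner_smul_right,
      -- Compatibility gives skewness only against the range of `f`. Surjectivity of `Q` and `Q w =
      -- η(w) ξ - f² w` extend it to every vector, the `ξ` part being harmless.
      real_inner_comm, real_inner_comm (S.ξ x), S.inner_ξ]
    ring
  obtain ⟨w, rfl⟩ := (S.nonsingular_Q x).2 v
  have hw : S.Q x w = S.η x w • S.ξ x - S.f x (S.f x w) := by
    rw [S.f_sq]
    abel
  rw [hw, inner_sub_right, inner_smul_right, real_inner_comm, S.inner_ξ, S.η_f, key, map_sub,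
    map_smul, S.f_ξ, smul_zero, zero_sub, inner_neg_right]
  ring

end Pointwise

/-! ### The commutator of `f` with the curvature -/

section Kenmotsu

variable {n : ℕ} {S : WeakAlmostContactMetricStructure I M n} {β : ℝ}

theorem contMDiff_f (S : WeakAlmostContactMetricStructure I M n) (hX : CMDiff ∞ (T% X)) :
    CMDiff ∞ (T% (fun y => S.f y (X y))) :=
  S.smooth_f.clm_bundle_apply hX

theorem cov_f [T2Space M] (hS : S.IsWeakKenmotsu cov (fun _ => β)) (hY : CMDiff ∞ (T% Y)) (x : M)
    (u : TangentSpace I x) :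
    cov (fun y => S.f y (Y y)) x u = S.f x (cov Y x u) +
      β • ((inner ℝ (S.f x u) (Y x) : ℝ) • S.ξ x - S.η x (Y x) • S.f x u) := by
  obtain ⟨X, hX, rfl⟩ := exists_contMDiff_eq x u
  rw [← hS.nabla_f X Y hX hY]
  abel

theorem cov_ξ [T2Space M] (hcov : IsLeviCivita cov) (hS : S.IsWeakKenmotsu cov (fun _ => β))
    (x : M) (u : TangentSpace I x) :
    cov S.ξ x u = β • (u - S.η x u • S.ξ x) := by
  have h := cov_f hS S.smooth_ξ x u
  -- With `Y = ξ` the field `f Y` is zero, so `h` determines `∇_u ξ` modulo `ker f`; the remaining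
  -- `ξ` component vanishes because `ξ` has unit length.
  simp only [S.f_ξ] at h
  have h0 : cov (fun y => (0 : TangentSpace I y)) x u = 0 := by
    simpa using cov_const_smul (cov := cov) 0 S.smooth_ξ x u
  rw [h0, real_inner_comm, S.inner_ξ, S.η_f, S.η_ξ, zero_smul, zero_sub, one_smul, smul_neg,
    ← sub_eq_add_neg, ← map_smul, ← map_sub] at h
  have h1 := S.eq_of_f_eq_zero x h.symm
  have h2 := hcov.mvfderiv_inner S.smooth_ξ S.smooth_ξ x u
  simp only [S.inner_ξ, S.η_ξ] at h2
  rw [mvfderiv_const, real_inner_comm, S.inner_ξ] at h2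
  have h3 : S.η x (cov S.ξ x u) = 0 := by
    have : (0 : ℝ) = S.η x (cov S.ξ x u) + S.η x (cov S.ξ x u) := h2
    linarith
  rw [map_sub, h3, map_smul, sub_eq_iff_eq_add] at h1
  rw [h1, smul_eq_mul]
  module

/-- The second covariant derivative of `f Z`. -/
theorem cov_cov_f [T2Space M] (hcov : IsLeviCivita cov) (hS : S.IsWeakKenmotsu cov (fun _ => β))
    (hY : CMDiff ∞ (T% Y)) (hZ : CMDiff ∞ (T% Z)) (x : M) :
    cov (fun y => cov (fun y => S.f y (Z y)) y (Y y)) x (X x) =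
      S.f x (cov (fun y => cov Z y (Y y)) x (X x))
      + β • ((inner ℝ (S.f x (X x)) (cov Z x (Y x)) : ℝ) • S.ξ x
        - S.η x (cov Z x (Y x)) • S.f x (X x))
      + β • ((inner ℝ (S.f x (Y x)) (Z x) : ℝ) • (β • (X x - S.η x (X x) • S.ξ x))
        + (inner ℝ (S.f x (cov Y x (X x)) +
            β • ((inner ℝ (S.f x (X x)) (Y x) : ℝ) • S.ξ x - S.η x (Y x) • S.f x (X x))) (Z x)
          + inner ℝ (S.f x (Y x)) (cov Z x (X x)) : ℝ) • S.ξ x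
        - (S.η x (Z x) • (S.f x (cov Y x (X x)) +
            β • ((inner ℝ (S.f x (X x)) (Y x) : ℝ) • S.ξ x - S.η x (Y x) • S.f x (X x)))
          + (inner ℝ (β • (X x - S.η x (X x) • S.ξ x)) (Z x) + S.η x (cov Z x (X x)) : ℝ) •
            S.f x (Y x))) := by
  have hfY := S.contMDiff_f hY
  have hZY := hcov.contMDiff_cov hY hZ
  have hg := contMDiff_inner hfY hZ
  have hη := contMDiff_inner S.smooth_ξ hZ
  have h1 : CMDiff ∞ (T% (fun y => (inner ℝ (S.f y (Y y)) (Z y) : ℝ) • S.ξ y)) :=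
    hg.smul_section S.smooth_ξ
  have h2 : CMDiff ∞ (T% (fun y => (inner ℝ (S.ξ y) (Z y) : ℝ) • S.f y (Y y))) :=
    hη.smul_section hfY
  have h12 : CMDiff ∞ (T% (fun y => (inner ℝ (S.f y (Y y)) (Z y) : ℝ) • S.ξ y
      - (inner ℝ (S.ξ y) (Z y) : ℝ) • S.f y (Y y))) := h1.sub_section h2
  have h3 : CMDiff ∞ (T% (fun y => β • ((inner ℝ (S.f y (Y y)) (Z y) : ℝ) • S.ξ y
      - (inner ℝ (S.ξ y) (Z y) : ℝ) • S.f y (Y y)))) := h12.const_smul_section (a := β)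
  -- Writing `η` as `⟪ξ, ·⟫` lets metric compatibility differentiate `η(Z)`.
  simp only [fun y => cov_f hS hZ y (Y y), ← S.inner_ξ]
  rw [cov_add (S.contMDiff_f hZY) h3, cov_const_smul β h12,
    cov_sub h1 h2, cov_smul hg S.smooth_ξ, cov_smul hη hfY, hcov.mvfderiv_inner hfY hZ,
    hcov.mvfderiv_inner S.smooth_ξ hZ, cov_ξ hcov hS, cov_f hS hZY, cov_f hS hY]
  simp only [S.inner_ξ]

/-- On antisymmetrizing `cov_cov_f`, first derivatives of `Z` cancel, those of `X`, `Y` combine into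
the bracket, and the `β²` terms containing `ξ` or `η` cancel or are symmetric in `X`, `Y`. Constancy
of `β` means no `dβ` term appears. -/
theorem curvatureField_f [T2Space M] (hcov : IsLeviCivita cov)
    (hS : S.IsWeakKenmotsu cov (fun _ => β))
    (hX : CMDiff ∞ (T% X)) (hY : CMDiff ∞ (T% Y)) (hZ : CMDiff ∞ (T% Z)) (x : M) :
    curvatureField cov X Y (fun y => S.f y (Z y)) x = S.f x (curvatureField cov X Y Z x) +
      β ^ 2 • ((inner ℝ (S.f x (Y x)) (Z x) : ℝ) • X x - (inner ℝ (X x) (Z x) : ℝ) • S.f x (Y x)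
        - (inner ℝ (S.f x (X x)) (Z x) : ℝ) • Y x + (inner ℝ (Y x) (Z x) : ℝ) • S.f x (X x)) := by
  have hs : (inner ℝ (S.f x (Y x)) (X x) : ℝ) = - inner ℝ (S.f x (X x)) (Y x) := by
    rw [S.inner_f_left, real_inner_comm]
  simp only [curvatureField]
  rw [cov_cov_f hcov hS hY hZ, cov_cov_f hcov hS hX hZ, cov_f hS hZ,
    ← hcov.cov_sub_cov hX hY, hs]
  simp only [map_sub, inner_add_left, inner_sub_left, inner_smul_left, S.inner_ξ, conj_trivial]
  module

theorem curvature_f [T2Space M] (hcov : IsLeviCivita cov)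
    (hS : S.IsWeakKenmotsu cov (fun _ => β)) (x : M) (u v w : TangentSpace I x) :
    curvature cov x u v (S.f x w) = S.f x (curvature cov x u v w) +
      β ^ 2 • ((inner ℝ (S.f x v) w : ℝ) • u - (inner ℝ u w : ℝ) • S.f x v
        - (inner ℝ (S.f x u) w : ℝ) • v + (inner ℝ v w : ℝ) • S.f x u) := by
  obtain ⟨X, hX, rfl⟩ := exists_contMDiff_eq x u
  obtain ⟨Y, hY, rfl⟩ := exists_contMDiff_eq x v
  obtain ⟨Z, hZ, rfl⟩ := exists_contMDiff_eq x w
  rw [curvature_eq_curvatureField hcov hX hY hZ, ← curvatureField_f hcov hS hX hY hZ]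
  exact curvature_eq_curvatureField hcov hX hY (S.contMDiff_f hZ) x

end Kenmotsu

end WeakAlmostContactMetricStructure

/-! ### The `∗`-Ricci tensor and the `∗`-scalar curvature -/

section Main

variable [T2Space M] {n : ℕ} {S : WeakAlmostContactMetricStructure I M n} {β : ℝ}

theorem ricci_eq_trace (hcov : IsLeviCivita cov) (x : M) (u v : TangentSpace I x) :
    ricci cov x u v =
      LinearMap.trace ℝ (TangentSpace I x) (ricciEndomorphism (curvatureLinear hcov x) u v) :=
  metricTrace_eq_trace (ricciEndomorphism (curvatureLinear hcov x) u v)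

theorem ricci_add_right (hcov : IsLeviCivita cov) (x : M) (u v w : TangentSpace I x) :
    ricci cov x u (v + w) = ricci cov x u v + ricci cov x u w := by
  simp only [ricci_eq_trace hcov, ricciEndomorphism, map_add]

theorem ricci_smul_right (hcov : IsLeviCivita cov) (x : M) (c : ℝ) (u v : TangentSpace I x) :
    ricci cov x u (c • v) = c * ricci cov x u v := by
  simp only [ricci_eq_trace hcov, ricciEndomorphism, map_smul, smul_eq_mul]

theorem inner_ricciSharp (hcov : IsLeviCivita cov) (x : M) (u v : TangentSpace I x) :
    (inner ℝ (ricciSharp cov x u) v : ℝ) = ricci cov x u v := by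
  let L : TangentSpace I x →ₗ[ℝ] ℝ :=
    { toFun := ricci cov x u
      map_add' := ricci_add_right hcov x u
      map_smul' := fun c => ricci_smul_right hcov x c u }
  change _ = L v
  conv_rhs => rw [← (stdOrthonormalBasis ℝ (TangentSpace I x)).sum_repr' v]
  rw [ricciSharp, sum_inner, map_sum]
  refine Finset.sum_congr rfl fun i _ => ?_
  rw [inner_smul_left, map_smul, smul_eq_mul, mul_comm]
  rfl

theorem starRicci_eq (hcov : IsLeviCivita cov) (hS : S.IsWeakKenmotsu cov (fun _ => β)) (x : M)
    (hn : Module.finrank ℝ (TangentSpace I x) = 2 * n + 1) (u v : TangentSpace I x) :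
    S.starRicci cov x u v = ricci cov x u (S.Q x v)
      + β ^ 2 * ((2 * (n : ℝ) - 1) * inner ℝ u (S.Q x v) + S.η x u * S.η x v) := by
  have h := half_trace_comp_curvature (R := curvatureLinear hcov x) (f := (S.f x).toLinearMap)
    (Q := (S.Q x).toLinearMap) (ξ := S.ξ x) (c := β ^ 2) hn (curvature_swap hcov x)
    (inner_curvature_pair hcov x) (curvature_bianchi hcov x) (S.inner_f_left x)
    (fun a => by rw [S.inner_ξ]; exact S.f_sq x a)
    (fun a ha => by rw [S.inner_ξ]; exact S.eq_of_f_eq_zero x ha) (S.f_ξ x)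
    (WeakAlmostContactMetricStructure.curvature_f hcov hS x) u v
  rw [S.inner_ξ, S.inner_ξ] at h
  rw [ricci_eq_trace hcov, WeakAlmostContactMetricStructure.starRicci]
  refine Eq.trans ?_ h
  congr 1
  exact metricTrace_eq_trace ((S.f x).toLinearMap ∘ₗ curvatureLinear hcov x u (S.f x v))

theorem starScalar_eq (hcov : IsLeviCivita cov) (hS : S.IsWeakKenmotsu cov (fun _ => β)) (x : M)
    (hn : Module.finrank ℝ (TangentSpace I x) = 2 * n + 1) :
    S.starScalar cov x = metricTrace (fun v : TangentSpace I x => S.Q x (ricciSharp cov x v))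
      + β ^ 2 * (4 * (n : ℝ) ^ 2 + (2 * (n : ℝ) - 1) *
        LinearMap.trace ℝ (TangentSpace I x) (S.Qtilde x).toLinearMap) := by
  set e := stdOrthonormalBasis ℝ (TangentSpace I x) with he
  -- Self-adjointness of `Q` matches the Ricci sum. With `tr Q = tr Q̃ + 2n + 1` and `∑ η(eᵢ)² =
  -- |ξ|² = 1`, the constant is `(2n-1)(2n+1) + 1 = 4n²`.
  have h1 : metricTrace (fun v : TangentSpace I x => S.Q x (ricciSharp cov x v)) =
      ∑ i, ricci cov x (e i) (S.Q x (e i)) :=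
    Finset.sum_congr rfl fun i _ => by
      rw [S.inner_Q_comm, inner_ricciSharp hcov]
  have h2 : ∑ i, (inner ℝ (e i) (S.Q x (e i)) : ℝ) =
      LinearMap.trace ℝ (TangentSpace I x) (S.Qtilde x).toLinearMap + (2 * n + 1) := by
    have hQ : (S.Q x).toLinearMap = (S.Qtilde x).toLinearMap + LinearMap.id := by
      ext v
      simp [WeakAlmostContactMetricStructure.Qtilde]
    have ht : LinearMap.trace ℝ (TangentSpace I x) (S.Q x).toLinearMap =
        LinearMap.trace ℝ (TangentSpace I x) (S.Qtilde x).toLinearMap + (2 * n + 1) := by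
      rw [hQ, map_add, LinearMap.trace_id, hn]
      push_cast
      ring
    exact (LinearMap.trace_eq_sum_inner (S.Q x).toLinearMap e).symm.trans ht
  have h3 : ∑ i, S.η x (e i) * S.η x (e i) = 1 := by
    have := e.sum_inner_mul_inner (S.ξ x) (S.ξ x)
    rw [S.inner_ξ, S.η_ξ] at this
    rw [← this]
    refine Finset.sum_congr rfl fun i _ => ?_
    rw [real_inner_comm (S.ξ x) (e i), S.inner_ξ]
  rw [h1, WeakAlmostContactMetricStructure.starScalar]
  simp only [starRicci_eq hcov hS x hn, Finset.sum_add_distrib, ← Finset.mul_sum]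
  rw [← he, h2, h3]
  ring

end Main

end LeviCivita

end Curvature

end WeakKenmotsu

end

theorem theorem1 (n : ℕ) {M : Type*} [TopologicalSpace M] [T2Space M]
    [ChartedSpace (EuclideanSpace ℝ (Fin (2 * n + 1))) M] [IsManifold (𝓡 (2 * n + 1)) ∞ M]
    [RiemannianBundle (fun x : M => TangentSpace (𝓡 (2 * n + 1)) x)]
    [IsContMDiffRiemannianBundle (𝓡 (2 * n + 1)) ∞ (EuclideanSpace ℝ (Fin (2 * n + 1)))
      (fun x : M => TangentSpace (𝓡 (2 * n + 1)) x)]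
    (cov : CovariantDerivative (𝓡 (2 * n + 1)) (EuclideanSpace ℝ (Fin (2 * n + 1)))
      (TangentSpace (𝓡 (2 * n + 1)) : M → Type _))
    (hcov : WeakKenmotsu.IsLeviCivita cov)
    (S : WeakKenmotsu.WeakAlmostContactMetricStructure (𝓡 (2 * n + 1)) M n)
    (β : ℝ) (hS : S.IsWeakKenmotsu cov (fun _ => β)) :
    (∀ (x : M) (X Y : TangentSpace (𝓡 (2 * n + 1)) x),
      S.starRicci cov x X Y = WeakKenmotsu.ricci cov x X (S.Q x Y)
        + β ^ 2 * ((2 * (n : ℝ) - 1) * inner ℝ X (S.Q x Y) + S.η x X * S.η x Y)) ∧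
    (∀ x : M,
      S.starScalar cov x =
        WeakKenmotsu.metricTrace
          (fun v : TangentSpace (𝓡 (2 * n + 1)) x => S.Q x (WeakKenmotsu.ricciSharp cov x v))
        + β ^ 2 * (4 * (n : ℝ) ^ 2 + (2 * (n : ℝ) - 1) *
            LinearMap.trace ℝ (TangentSpace (𝓡 (2 * n + 1)) x) (S.Qtilde x).toLinearMap)) := by
  have hn : ∀ x : M, Module.finrank ℝ (TangentSpace (𝓡 (2 * n + 1)) x) = 2 * n + 1 := fun _ =>
    finrank_euclideanSpace_fin
  exact ⟨fun x => WeakKenmotsu.starRicci_eq hcov hS x (hn x),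
    fun x => WeakKenmotsu.starScalar_eq hcov hS x (hn x)⟩
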